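/- Let $d\ge 2$. For $x,y\in\mathbb Z^d$ write $y\preceq x$ if $x_iy_i\ge 0$ and $|y_i|\le |x_i|$ for every $i\in\{1,\dots,d\}$, and $y_i=x_i$ for every $i<n(y)$, where $n(y)$ is the index of the last nonzero coordinate of $y$ (the last condition is void if $y=0$). A set $K\subset\mathbb Z^d$ is called descending if it is finite, contains $0$, and contains every $y\in\mathbb Z^d$ such that $y\preceq x$ for some $x\in K$. A bond is the closed segment in $\mathbb R^d$ joining two points of $\mathbb Z^d$ at Euclidean distance $1$. A sphere in $\mathbb R^d$ is a subset of $\mathbb R^d$ that is the underlying set of a finite simplicial complex in $\mathbb R^d$ and is homeomorphic to the unit sphere $S^{d-1}=\{x\in\mathbb R^d: x_1^2+\dots+x_d^2=1\}$; its inside is the bounded part of its complement, i.e. the set of points of the complement whose connected component in the complement is bounded. **Proposition 3.1.** Let $d\ge 2$ and let $K\subset\mathbb Z^d$ be a descending set. Then there is a sphere $S\subset\mathbb R^d$, containing no point of $\mathbb Z^d$ and such that the points of $\mathbb Z^d$ in its inside are exactly those of $K$, which intersects every bond that has one endpoint in $K$ and the other in $\mathbb Z^d\setminus K$, and no other bond.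 -/

import Mathlib

/-- The point of `ℝ^d` with integer coordinates `x`. -/
noncomputable def latticePoint {d : ℕ} (x : Fin d → ℤ) : EuclideanSpace ℝ (Fin d) :=
  WithLp.toLp 2 fun i => (x i : ℝ)

/-- Two vertices of `ℤ^d` are neighbours if their Euclidean distance is one. -/
def AreNeighbours {d : ℕ} (x y : Fin d → ℤ) : Prop :=
  dist (latticePoint x) (latticePoint y) = 1

/-- The bond of the edge `x, y`: the closed segment of `ℝ^d` that joins `x` to `y`. -/
def bond {d : ℕ} (x y : Fin d → ℤ) : Set (EuclideanSpace ℝ (Fin d)) :=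
  segment ℝ (latticePoint x) (latticePoint y)

/-- The order `y ⪯ x`: each `y i` lies between `0` and `x i`, and `y` agrees with `x` at every index
strictly before the last nonzero coordinate of `y`. An index `i` is strictly before the last nonzero
coordinate of `y` iff `y j ≠ 0` for some `j > i`; for `y = 0` the last condition is void. -/
def BrokenLineLE {d : ℕ} (y x : Fin d → ℤ) : Prop :=
  (∀ i, 0 ≤ x i * y i) ∧ (∀ i, |y i| ≤ |x i|) ∧ ∀ i, (∃ j, i < j ∧ y j ≠ 0) → y i = x i

/-- A descending set: a finite set of vertices that contains `0` and is closed downwards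
for the order `⪯`. -/
structure IsDescending {d : ℕ} (K : Set (Fin d → ℤ)) : Prop where
  finite : K.Finite
  zero_mem : (0 : Fin d → ℤ) ∈ K
  down_closed : ∀ x ∈ K, ∀ y, BrokenLineLE y x → y ∈ K

/-- A sphere of `ℝ^d`: the underlying set of a finite simplicial complex of `ℝ^d` that is
homeomorphic to the unit Euclidean sphere of `ℝ^d`. -/
def IsSimplicialSphere {d : ℕ} (S : Set (EuclideanSpace ℝ (Fin d))) : Prop :=
  (∃ T : Geometry.SimplicialComplex ℝ (EuclideanSpace ℝ (Fin d)), T.faces.Finite ∧ T.space = S) ∧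
    Nonempty (S ≃ₜ Metric.sphere (0 : EuclideanSpace ℝ (Fin d)) 1)

/-- The inside of `S`: the points of the complement of `S` whose connected component in that
complement is bounded. -/
def inside {d : ℕ} (S : Set (EuclideanSpace ℝ (Fin d))) : Set (EuclideanSpace ℝ (Fin d)) :=
  {p | p ∈ Sᶜ ∧ Bornology.IsBounded (connectedComponentIn Sᶜ p)}

/-! The sphere is the zero set of one piecewise affine function, `excess`. The region where it is
nonpositive is triangular: coordinate `i` ranges over an interval around `0` whose two ends, the
values of `extent`, are positive and depend only on the earlier coordinates. Near the first
coordinates of a point `z` of `K` the interval reaches half a unit beyond `z i`; a plateau has no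
effect once the earlier coordinates are at ℓ¹ distance at least one.

Triangularity gives the topology. Rescaling each coordinate by its extents is a continuous bijection
of the space that turns the region into a cube (`straighten`), so the zero set is homeomorphic to
the boundary of a cube. A point of positive excess escapes to infinity along a coordinate ray, since
moving in direction `i` does not change the extents in that direction. The zero set is a polyhedron
because it is a bounded union of closed cells of a hyperplane arrangement, which chains of cells
triangulate as in a barycentric subdivision.

The combinatorics is a sign check on bonds. A bond within `K` stays in the interior because each
half of it lies under the plateau of its nearer end (`excess_neg_of_mem_bond`). For a bond outside
`K`, the order `⪯` enters through truncations: if `z` truncated after index `i` is not in `K`, every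
point of `K` agreeing with `z` before `i` falls short of `z i` by a full unit. At the first index
where both truncated ends have left `K`, the whole bond lies beyond the extent
(`IsDescending.excess_pos_of_mem_bond`). Bonds with one end in `K` are crossed by the intermediate
value theorem. -/

/-! ### Triangulating unions of closed cells of a hyperplane arrangement -/

section Triangulation

variable {E : Type*} [AddCommGroup E] [Module ℝ E] {ι : Type*}

/-- `y` lies in the closure of the cell of `x` in the arrangement of the hyperplanes `ℓ i = 0`. -/
def SignLE (ℓ : ι → E →ᵃ[ℝ] ℝ) (y x : E) : Prop :=
  ∀ i, (0 ≤ ℓ i x → 0 ≤ ℓ i y) ∧ (ℓ i x ≤ 0 → ℓ i y ≤ 0)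

/-- The sign vector of a point with respect to a family of affine functions. -/
noncomputable def signVec (ℓ : ι → E →ᵃ[ℝ] ℝ) (x : E) : ι → SignType :=
  fun i => SignType.sign (ℓ i x)

/-- The marked point of the cell of `x`. -/
noncomputable def cellPoint (ℓ : ι → E →ᵃ[ℝ] ℝ) (x : E) : E :=
  Function.invFun (signVec ℓ) (signVec ℓ x)

variable {ℓ : ι → E →ᵃ[ℝ] ℝ}

theorem SignLE.refl (x : E) : SignLE ℓ x x := fun _ => ⟨id, id⟩

theorem SignLE.trans {x y z : E} (h : SignLE ℓ x y) (h' : SignLE ℓ y z) : SignLE ℓ x z :=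
  fun i => ⟨fun a => (h i).1 ((h' i).1 a), fun a => (h i).2 ((h' i).2 a)⟩

theorem SignLE.eq_zero {x y : E} (h : SignLE ℓ y x) {i : ι} (hx : ℓ i x = 0) : ℓ i y = 0 :=
  le_antisymm ((h i).2 hx.le) ((h i).1 hx.ge)

theorem signVec_eq_iff {x y : E} :
    signVec ℓ x = signVec ℓ y ↔ SignLE ℓ x y ∧ SignLE ℓ y x := by
  constructor
  · intro h
    have h' : ∀ i, SignType.sign (ℓ i x) = SignType.sign (ℓ i y) := fun i => congrFun h i
    refine ⟨fun i => ⟨?_, ?_⟩, fun i => ⟨?_, ?_⟩⟩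
    · rw [← sign_nonneg_iff, ← h' i, sign_nonneg_iff]; exact id
    · rw [← sign_nonpos_iff, ← h' i, sign_nonpos_iff]; exact id
    · rw [← sign_nonneg_iff, h' i, sign_nonneg_iff]; exact id
    · rw [← sign_nonpos_iff, h' i, sign_nonpos_iff]; exact id
  · rintro ⟨h, h'⟩
    funext i
    rcases lt_trichotomy (ℓ i x) 0 with hx | hx | hx
    · have : ℓ i y < 0 := by
        by_contra hc
        exact absurd ((h i).1 (not_lt.1 hc)) (not_le.2 hx)
      simp [signVec, sign_neg hx, sign_neg this]
    · simp [signVec, hx, h'.eq_zero hx]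
    · have : 0 < ℓ i y := by
        by_contra hc
        exact absurd ((h i).2 (not_lt.1 hc)) (not_le.2 hx)
      simp [signVec, sign_pos hx, sign_pos this]

theorem signVec_cellPoint (x : E) : signVec ℓ (cellPoint ℓ x) = signVec ℓ x :=
  Function.invFun_eq ⟨x, rfl⟩

theorem cellPoint_eq_of_signVec_eq {x y : E} (h : signVec ℓ x = signVec ℓ y) :
    cellPoint ℓ x = cellPoint ℓ y := by
  rw [cellPoint, h, cellPoint]

/-- Otherwise `u` and `v` have the same sign vector, and a cell has only one marked point. -/
theorem SignLE.exists_of_ne {u v : E} (hu : cellPoint ℓ u = u) (hv : cellPoint ℓ v = v)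
    (huv : u ≠ v) (h : SignLE ℓ u v) : ∃ i, ℓ i u = 0 ∧ ℓ i v ≠ 0 := by
  by_contra! hc
  apply huv
  rw [← hu, ← hv]
  apply cellPoint_eq_of_signVec_eq
  refine signVec_eq_iff.2 ⟨h, fun i => ⟨fun h0 => ?_, fun h0 => ?_⟩⟩
  · by_contra hn
    exact (not_le.2 (not_le.1 hn)) ((hc i (le_antisymm ((h i).2 (not_le.1 hn).le) h0)).ge)
  · by_contra hn
    exact (not_le.2 (not_le.1 hn)) ((hc i (le_antisymm h0 ((h i).1 (not_le.1 hn).le))).le)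

theorem convex_setOf_signLE (x : E) : Convex ℝ {y | SignLE ℓ y x} := by
  intro a ha b hb s t hs ht hst i
  have : ℓ i (s • a + t • b) = s * ℓ i a + t * ℓ i b := by
    have := Convex.combo_affine_apply (f := ℓ i) (x := a) (y := b) hst
    simpa using this
  rw [this]
  refine ⟨fun h => ?_, fun h => ?_⟩
  · have := (ha i).1 h
    have := (hb i).1 h
    positivity
  · have := mul_nonneg hs (neg_nonneg.2 ((ha i).2 h))
    have := mul_nonneg ht (neg_nonneg.2 ((hb i).2 h))
    linarith

/-- A finite set of marked points whose cells form a chain. -/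
def IsFlag (ℓ : ι → E →ᵃ[ℝ] ℝ) (s : Finset E) : Prop :=
  (∀ v ∈ s, cellPoint ℓ v = v) ∧ ∀ v ∈ s, ∀ w ∈ s, SignLE ℓ v w ∨ SignLE ℓ w v

theorem IsFlag.mono {s t : Finset E} (hs : IsFlag ℓ s) (h : t ⊆ s) : IsFlag ℓ t :=
  ⟨fun v hv => hs.1 v (h hv), fun v hv w hw => hs.2 v (h hv) w (h hw)⟩

theorem IsFlag.exists_top {s : Finset E} (hs : IsFlag ℓ s) (hne : s.Nonempty) :
    ∃ v ∈ s, ∀ w ∈ s, SignLE ℓ w v := by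
  classical
  induction hne using Finset.Nonempty.cons_induction with
  | singleton a => exact ⟨a, by simp, by simpa using SignLE.refl a⟩
  | cons a s ha hne ih =>
    obtain ⟨v, hv, hvs⟩ := ih (hs.mono (by simp))
    rcases hs.2 a (by simp) v (by simp [hv]) with h | h
    · refine ⟨v, by simp [hv], fun w hw => ?_⟩
      rcases Finset.mem_cons.1 hw with rfl | hw
      exacts [h, hvs w hw]
    · refine ⟨a, by simp, fun w hw => ?_⟩
      rcases Finset.mem_cons.1 hw with rfl | hw
      exacts [SignLE.refl _, (hvs w hw).trans h]

/-- Below the top of a flag, some affine function of the family vanishes without vanishing at the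
top. -/
theorem IsFlag.exists_separating [DecidableEq E] {s : Finset E} (hs : IsFlag ℓ s) {v : E}
    (hv : v ∈ s) (htop : ∀ w ∈ s, SignLE ℓ w v) (hne : (s.erase v).Nonempty) :
    ∃ i, ℓ i v ≠ 0 ∧ ∀ w ∈ s.erase v, ℓ i w = 0 := by
  obtain ⟨u, hu, hus⟩ := (hs.mono (s.erase_subset v)).exists_top hne
  have hu' := Finset.mem_erase.1 hu
  obtain ⟨i, hi, hi'⟩ := SignLE.exists_of_ne (hs.1 u hu'.2) (hs.1 v hv) hu'.1 (htop u hu'.2)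
  exact ⟨i, hi', fun w hw => (hus w hw).eq_zero hi⟩

theorem AffineMap.sum_mul_apply (g : E →ᵃ[ℝ] ℝ) (s : Finset E) (w : E → ℝ) :
    ∑ v ∈ s, w v * g v = g.linear (∑ v ∈ s, w v • v) + (∑ v ∈ s, w v) * g 0 := by
  rw [map_sum, Finset.sum_mul, ← Finset.sum_add_distrib]
  refine Finset.sum_congr rfl fun v _ => ?_
  have hg : g v = g.linear v + g 0 := congrFun g.decomp v
  rw [hg, map_smul, smul_eq_mul, mul_add]

theorem AffineMap.sum_mul_apply_congr (g : E →ᵃ[ℝ] ℝ) {s t : Finset E} {w w' : E → ℝ}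
    (h0 : ∑ v ∈ s, w v = ∑ v ∈ t, w' v) (h1 : ∑ v ∈ s, w v • v = ∑ v ∈ t, w' v • v) :
    ∑ v ∈ s, w v * g v = ∑ v ∈ t, w' v * g v := by
  rw [g.sum_mul_apply, g.sum_mul_apply, h0, h1]

/-- Applying a separating function to the relation leaves only the term of the top vertex, whose
weight is therefore zero; the rest follows by removing the top. -/
theorem IsFlag.weights_eq_zero [DecidableEq E] {s : Finset E} (hs : IsFlag ℓ s) {w : E → ℝ}
    (h0 : ∑ v ∈ s, w v = 0) (h1 : ∑ v ∈ s, w v • v = 0) : ∀ v ∈ s, w v = 0 := by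
  induction s using Finset.strongInduction with
  | H s ih =>
    rcases s.eq_empty_or_nonempty with rfl | hne
    · simp
    obtain ⟨v, hv, htop⟩ := hs.exists_top hne
    have key : w v = 0 := by
      rcases (s.erase v).eq_empty_or_nonempty with he | he
      · rw [← Finset.add_sum_erase s _ hv, he] at h0
        simpa using h0
      · obtain ⟨i, hi, hi'⟩ := hs.exists_separating hv htop he
        have := (ℓ i).sum_mul_apply s w
        rw [h0, h1, ← Finset.add_sum_erase s _ hv,
          Finset.sum_eq_zero fun u hu => by rw [hi' u hu, mul_zero]] at this
        simpa [hi] using this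
    rw [← Finset.add_sum_erase s _ hv, key, zero_add] at h0
    rw [← Finset.add_sum_erase s _ hv, key, zero_smul, zero_add] at h1
    intro u hu
    by_cases huv : u = v
    · rw [huv, key]
    · exact ih _ (Finset.erase_ssubset hv) (hs.mono (s.erase_subset v)) h0 h1 u
        (Finset.mem_erase.2 ⟨huv, hu⟩)

theorem IsFlag.affineIndependent {s : Finset E} (hs : IsFlag ℓ s) :
    AffineIndependent ℝ ((↑) : s → E) := by
  classical
  rw [affineIndependent_iff]
  intro t w h0 h1 e he
  let w' : E → ℝ := fun v => if h : v ∈ s then w ⟨v, h⟩ else 0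
  have hw' : ∀ v : s, w' v = w v := fun v => by simp [w']
  have := (hs.mono (t := t.map (Function.Embedding.subtype _)) (fun v hv => by
    obtain ⟨u, _, rfl⟩ := Finset.mem_map.1 hv
    exact u.2)).weights_eq_zero (w := w') (by simpa [hw'] using h0) (by simpa [hw'] using h1)
    e (Finset.mem_map.2 ⟨e, he, rfl⟩)
  rwa [hw'] at this

/-- With positive weights, the weight of the top vertex of a flag is bounded by that of any other
flag with the same top vertex and the same weighted sum. -/
theorem IsFlag.top_weight_le [DecidableEq E] {s t : Finset E} (ht : IsFlag ℓ t) {w w' : E → ℝ}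
    (hw : ∀ v ∈ s, 0 < w v) (h0 : ∑ v ∈ s, w v = ∑ v ∈ t, w' v)
    (h1 : ∑ v ∈ s, w v • v = ∑ v ∈ t, w' v • v) {v : E} (hvs : v ∈ s) (hvt : v ∈ t)
    (htops : ∀ u ∈ s, SignLE ℓ u v) (htopt : ∀ u ∈ t, SignLE ℓ u v) : w v ≤ w' v := by
  rcases (t.erase v).eq_empty_or_nonempty with he | he
  · rw [← Finset.add_sum_erase t _ hvt, he, Finset.sum_empty, add_zero] at h0
    rw [← h0]
    exact Finset.single_le_sum (f := w) (fun u hu => (hw u hu).le) hvs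
  · obtain ⟨i, hi, hi'⟩ := ht.exists_separating hvt htopt he
    have := (ℓ i).sum_mul_apply_congr h0 h1
    rw [← Finset.add_sum_erase t _ hvt, Finset.sum_eq_zero (s := t.erase v)
      fun u hu => by rw [hi' u hu, mul_zero], add_zero, ← Finset.add_sum_erase s _ hvs] at this
    rcases lt_or_gt_of_ne hi with hneg | hpos
    · have : ∑ u ∈ s.erase v, w u * ℓ i u ≤ 0 := Finset.sum_nonpos fun u hu =>
        mul_nonpos_of_nonneg_of_nonpos (hw u (Finset.mem_of_mem_erase hu)).le
          ((htops u (Finset.mem_of_mem_erase hu) i).2 hneg.le)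
      nlinarith
    · have : 0 ≤ ∑ u ∈ s.erase v, w u * ℓ i u := Finset.sum_nonneg fun u hu =>
        mul_nonneg (hw u (Finset.mem_of_mem_erase hu)).le
          ((htops u (Finset.mem_of_mem_erase hu) i).1 hpos.le)
      nlinarith

/-- A strict sign at the top `a` passes to the weighted sum over `s`, since the other terms have
weakly the same sign; the equal sum over `t` has weakly the sign of the value at `b`. -/
theorem signLE_of_sum_eq {s t : Finset E} {w w' : E → ℝ}
    (hw : ∀ v ∈ s, 0 < w v) (hw' : ∀ v ∈ t, 0 < w' v) (h0 : ∑ v ∈ s, w v = ∑ v ∈ t, w' v)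
    (h1 : ∑ v ∈ s, w v • v = ∑ v ∈ t, w' v • v) {a b : E} (ha : a ∈ s)
    (htops : ∀ u ∈ s, SignLE ℓ u a) (htopt : ∀ u ∈ t, SignLE ℓ u b) : SignLE ℓ a b := by
  intro i
  have h := (ℓ i).sum_mul_apply_congr h0 h1
  constructor
  · intro hb
    by_contra hc
    have h2 : ∑ v ∈ s, w v * ℓ i v < 0 := by
      refine Finset.sum_neg' (fun u hu => ?_) ⟨a, ha, ?_⟩
      · exact mul_nonpos_of_nonneg_of_nonpos (hw u hu).le ((htops u hu i).2 (not_le.1 hc).le)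
      · exact mul_neg_of_pos_of_neg (hw a ha) (not_le.1 hc)
    have h3 : 0 ≤ ∑ v ∈ t, w' v * ℓ i v := Finset.sum_nonneg fun u hu =>
      mul_nonneg (hw' u hu).le ((htopt u hu i).1 hb)
    linarith
  · intro hb
    by_contra hc
    have h2 : 0 < ∑ v ∈ s, w v * ℓ i v := by
      refine Finset.sum_pos' (fun u hu => ?_) ⟨a, ha, ?_⟩
      · exact mul_nonneg (hw u hu).le ((htops u hu i).1 (not_le.1 hc).le)
      · exact mul_pos (hw a ha) (not_le.1 hc)
    have h3 : ∑ v ∈ t, w' v * ℓ i v ≤ 0 := Finset.sum_nonpos fun u hu =>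
      mul_nonpos_of_nonneg_of_nonpos (hw' u hu).le ((htopt u hu i).2 hb)
    linarith

/-- The tops lie in the same cell, hence coincide, and so do their weights; both can then be
removed. The total weight is not normalized to one so that it may drop in this induction. -/
theorem IsFlag.eq_of_sum_eq [DecidableEq E] {s t : Finset E} (hs : IsFlag ℓ s) (ht : IsFlag ℓ t)
    {w w' : E → ℝ} (hw : ∀ v ∈ s, 0 < w v) (hw' : ∀ v ∈ t, 0 < w' v)
    (h0 : ∑ v ∈ s, w v = ∑ v ∈ t, w' v) (h1 : ∑ v ∈ s, w v • v = ∑ v ∈ t, w' v • v) :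
    s = t := by
  induction s using Finset.strongInduction generalizing t with
  | H s ih =>
    rcases s.eq_empty_or_nonempty with rfl | hne
    · rcases t.eq_empty_or_nonempty with rfl | hne'
      · rfl
      · have := Finset.sum_pos hw' hne'
        simp only [Finset.sum_empty] at h0
        linarith
    have hne' : t.Nonempty := by
      by_contra hc
      rw [Finset.not_nonempty_iff_eq_empty] at hc
      subst hc
      have := Finset.sum_pos hw hne
      simp only [Finset.sum_empty] at h0
      linarith
    obtain ⟨a, ha, htops⟩ := hs.exists_top hne
    obtain ⟨b, hb, htopt⟩ := ht.exists_top hne'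
    have hab : a = b := by
      rw [← hs.1 a ha, ← ht.1 b hb]
      exact cellPoint_eq_of_signVec_eq (signVec_eq_iff.2
        ⟨signLE_of_sum_eq hw hw' h0 h1 ha htops htopt,
          signLE_of_sum_eq hw' hw h0.symm h1.symm hb htopt htops⟩)
    subst hab
    have hwa : w a = w' a := le_antisymm (ht.top_weight_le hw h0 h1 ha hb htops htopt)
      (hs.top_weight_le hw' h0.symm h1.symm hb ha htopt htops)
    rw [← Finset.add_sum_erase s _ ha, ← Finset.add_sum_erase t _ hb, hwa] at h0 h1
    have := ih _ (Finset.erase_ssubset ha) (hs.mono (s.erase_subset a))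
      (ht.mono (t.erase_subset a)) (fun v hv => hw v (Finset.mem_of_mem_erase hv))
      (fun v hv => hw' v (Finset.mem_of_mem_erase hv)) (add_left_cancel h0) (add_left_cancel h1)
    rw [← Finset.insert_erase ha, this, Finset.insert_erase hb]

theorem Finset.exists_pos_weights_of_mem_convexHull [DecidableEq E] {s : Finset E} {x : E}
    (hx : x ∈ convexHull ℝ (s : Set E)) :
    ∃ t ⊆ s, ∃ w : E → ℝ, (∀ v ∈ t, 0 < w v) ∧ ∑ v ∈ t, w v = 1 ∧ ∑ v ∈ t, w v • v = x := by
  obtain ⟨w, hw, h0, h1⟩ := Finset.mem_convexHull'.1 hx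
  refine ⟨s.filter fun v => w v ≠ 0, s.filter_subset _, w, fun v hv => ?_, ?_, ?_⟩
  · obtain ⟨hv, hv'⟩ := Finset.mem_filter.1 hv
    exact lt_of_le_of_ne (hw v hv) hv'.symm
  · rw [Finset.sum_filter_ne_zero, h0]
  · rw [Finset.sum_filter_of_ne, h1]
    exact fun v _ hv h => hv (by rw [h, zero_smul])

theorem IsFlag.inter_subset_convexHull {s t : Finset E} (hs : IsFlag ℓ s) (ht : IsFlag ℓ t) :
    convexHull ℝ (s : Set E) ∩ convexHull ℝ (t : Set E) ⊆ convexHull ℝ (s ∩ t : Set E) := by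
  classical
  rintro x ⟨hxs, hxt⟩
  obtain ⟨s', hs', w, hw, h0, h1⟩ := Finset.exists_pos_weights_of_mem_convexHull hxs
  obtain ⟨t', ht', w', hw', h0', h1'⟩ := Finset.exists_pos_weights_of_mem_convexHull hxt
  have := (hs.mono hs').eq_of_sum_eq (ht.mono ht') hw hw' (h0.trans h0'.symm) (h1.trans h1'.symm)
  subst this
  have hsub : (s' : Set E) ⊆ (s : Set E) ∩ t := fun v hv => ⟨hs' hv, ht' hv⟩
  exact convexHull_mono hsub <| Finset.mem_convexHull'.2 ⟨w, fun v hv => (hw v hv).le, h0, h1⟩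

/-- The ray from the marked point `v` of the cell through `x` leaves the cell at a point of a
smaller face. Induction on the number of nonvanishing functions gives a flag for the exit point, and
`x` lies between that point and `v`. -/
theorem IsFlag.exists_mem_convexHull {E : Type*} [NormedAddCommGroup E] [NormedSpace ℝ E]
    {ι : Type*} [Fintype ι] {ℓ : ι → E →ᵃ[ℝ] ℝ} {S : Set E} (hb : Bornology.IsBounded S)
    (hS : ∀ x ∈ S, ∀ y, SignLE ℓ y x → y ∈ S) (x : E) (hx : x ∈ S) :
    ∃ s : Finset E, s.Nonempty ∧ IsFlag ℓ s ∧ (∀ v ∈ s, SignLE ℓ v x) ∧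
      x ∈ convexHull ℝ (s : Set E) := by
  classical
  induction hn : (Finset.univ.filter fun i => ℓ i x ≠ 0).card using Nat.strong_induction_on
    generalizing x with
  | _ n ih =>
  subst hn
  set v := cellPoint ℓ x with hv
  have hsv : signVec ℓ v = signVec ℓ x := signVec_cellPoint x
  obtain ⟨hvx, hxv⟩ := signVec_eq_iff.1 hsv
  have hvv : cellPoint ℓ v = v := cellPoint_eq_of_signVec_eq hsv
  by_cases hxeq : x = v
  · refine ⟨{x}, by simp, ⟨by simpa [← hxeq] using hvv, by simpa using SignLE.refl x⟩,
      by simpa using SignLE.refl x, by simp⟩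
  let y : ℝ → E := fun r => AffineMap.lineMap v x r
  have hy : ∀ i r, ℓ i (y r) = ℓ i v + r * (ℓ i x - ℓ i v) := by
    intro i r
    change ℓ i (AffineMap.lineMap v x r) = _
    rw [AffineMap.apply_lineMap, AffineMap.lineMap_apply_ring']
    ring
  -- indices whose hyperplane is approached along the ray from `v` through `x`
  let I : Finset ι := Finset.univ.filter fun i => ℓ i v * (ℓ i x - ℓ i v) < 0
  have hI : ∀ r, 0 ≤ r → (∀ i ∈ I, r * -(ℓ i v * (ℓ i x - ℓ i v)) ≤ ℓ i v ^ 2) →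
      SignLE ℓ (y r) x := by
    intro r hr h
    refine SignLE.trans (fun i => ?_) hvx
    have key : 0 ≤ ℓ i v * (ℓ i v + r * (ℓ i x - ℓ i v)) := by
      by_cases hi : i ∈ I
      · nlinarith [h i hi]
      · have : 0 ≤ ℓ i v * (ℓ i x - ℓ i v) := by
          simpa [I] using hi
        nlinarith [mul_nonneg hr this, sq_nonneg (ℓ i v)]
    rw [hy]
    rcases lt_trichotomy (ℓ i v) 0 with h0 | h0 | h0
    · exact ⟨fun h => absurd h (not_le.2 h0), fun _ => nonpos_of_mul_nonneg_right key h0⟩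
    · rw [h0, hxv.eq_zero h0]; simp
    · exact ⟨fun _ => nonneg_of_mul_nonneg_right key h0, fun h => absurd h (not_le.2 h0)⟩
  have hIne : I.Nonempty := by
    by_contra hc
    rw [Finset.not_nonempty_iff_eq_empty] at hc
    obtain ⟨C, hC⟩ := hb.exists_norm_le
    have hpos : 0 < ‖x - v‖ := norm_pos_iff.2 (sub_ne_zero.2 hxeq)
    have hCv : ‖v‖ ≤ C := hC v (hS x hx v hvx)
    have hC0 : 0 ≤ C := (norm_nonneg _).trans hCv
    -- If no hyperplane is approached, the whole ray stays in `S`. This parameter gives a point at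
    -- distance `2 * C + 1` from `v`, too far for two points of norm at most `C`.
    have h1 := hC (y ((2 * C + 1) / ‖x - v‖))
      (hS x hx _ (hI _ (by positivity) (by simp [hc])))
    have h2 : y ((2 * C + 1) / ‖x - v‖) = ((2 * C + 1) / ‖x - v‖) • (x - v) + v := by
      simp [y, AffineMap.lineMap_apply]
    have h3 : ‖((2 * C + 1) / ‖x - v‖) • (x - v)‖ = 2 * C + 1 := by
      rw [norm_smul, Real.norm_of_nonneg (by positivity), div_mul_cancel₀ _ hpos.ne']
    have h4 := norm_sub_le (((2 * C + 1) / ‖x - v‖) • (x - v) + v) v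
    rw [add_sub_cancel_right, h3, ← h2] at h4
    linarith
  obtain ⟨i, hi, hmin⟩ := I.exists_min_image
    (fun i => ℓ i v ^ 2 / -(ℓ i v * (ℓ i x - ℓ i v))) hIne
  set r := ℓ i v ^ 2 / -(ℓ i v * (ℓ i x - ℓ i v)) with hr
  have hIpos : ∀ j ∈ I, 0 < -(ℓ j v * (ℓ j x - ℓ j v)) := fun j hj =>
    neg_pos.2 (Finset.mem_filter.1 hj).2
  have hvi : ℓ i v ≠ 0 := by
    intro h
    have := hIpos i hi
    simp [h] at this
  have hri : r * -(ℓ i v * (ℓ i x - ℓ i v)) = ℓ i v ^ 2 :=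
    div_mul_cancel₀ _ (hIpos i hi).ne'
  have hyi : ℓ i (y r) = 0 := by
    rw [hy]
    apply mul_left_cancel₀ hvi
    linarith
  have hxi : 0 < ℓ i v * ℓ i x := by
    rcases lt_or_gt_of_ne hvi with h | h
    · refine mul_pos_of_neg_of_neg h (lt_of_le_of_ne ((hxv i).2 h.le) ?_)
      exact fun h0 => hvi (hvx.eq_zero h0)
    · refine mul_pos h (lt_of_le_of_ne ((hxv i).1 h.le) ?_)
      exact fun h0 => hvi (hvx.eq_zero h0.symm)
  -- The point `x`, at parameter `1`, is still strictly on the side of `v`.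
  have hr1 : 1 < r := by
    rw [hr, one_lt_div (hIpos i hi)]
    nlinarith
  have hyx : SignLE ℓ (y r) x := hI r (by linarith) fun j hj => by
    rw [← le_div_iff₀ (hIpos j hj)]
    exact hmin j hj
  have hcard : (Finset.univ.filter fun j => ℓ j (y r) ≠ 0).card <
      (Finset.univ.filter fun j => ℓ j x ≠ 0).card := by
    apply Finset.card_lt_card
    refine ⟨fun j hj => ?_, fun hsub => ?_⟩
    · simp only [Finset.mem_filter, Finset.mem_univ, true_and] at hj ⊢
      exact fun h => hj (hyx.eq_zero h)
    · have := hsub (Finset.mem_filter.2 ⟨Finset.mem_univ i, right_ne_zero_of_mul hxi.ne'⟩)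
      simp [hyi] at this
  obtain ⟨s, hsne, hs, hsy, hys⟩ := ih _ hcard (y r) (hS x hx _ hyx) rfl
  have hsx : ∀ u ∈ s, SignLE ℓ u x := fun u hu => (hsy u hu).trans hyx
  refine ⟨insert v s, Finset.insert_nonempty _ _, ⟨?_, ?_⟩, ?_, ?_⟩
  · intro u hu
    rcases Finset.mem_insert.1 hu with rfl | hu
    exacts [hvv, hs.1 u hu]
  · intro a ha b hb
    rcases Finset.mem_insert.1 ha with rfl | ha <;> rcases Finset.mem_insert.1 hb with rfl | hb
    · exact Or.inl (SignLE.refl _)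
    · exact Or.inr ((hsx b hb).trans hxv)
    · exact Or.inl ((hsx a ha).trans hxv)
    · exact hs.2 a ha b hb
  · intro u hu
    rcases Finset.mem_insert.1 hu with rfl | hu
    exacts [hvx, hsx u hu]
  · have hvm : v ∈ convexHull ℝ ((insert v s : Finset E) : Set E) :=
      subset_convexHull ℝ _ (by simp)
    have hym : y r ∈ convexHull ℝ ((insert v s : Finset E) : Set E) :=
      convexHull_mono (by simp) hys
    have hxy : x = AffineMap.lineMap v (y r) r⁻¹ := by
      simp only [y, AffineMap.lineMap_apply, vsub_eq_sub, vadd_eq_add, add_sub_cancel_right]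
      rw [smul_smul, inv_mul_cancel₀ (by linarith), one_smul, sub_add_cancel]
    rw [hxy]
    exact (convex_convexHull ℝ _).lineMap_mem hvm hym
      ⟨by positivity, inv_le_one_of_one_le₀ hr1.le⟩

/-- A bounded union of closed cells of a finite hyperplane arrangement is the underlying set of a
finite simplicial complex. -/
theorem exists_simplicialComplex_of_signLE {E : Type*} [NormedAddCommGroup E] [NormedSpace ℝ E]
    {ι : Type*} [Fintype ι] (ℓ : ι → E →ᵃ[ℝ] ℝ) {S : Set E} (hb : Bornology.IsBounded S)
    (hS : ∀ x ∈ S, ∀ y, SignLE ℓ y x → y ∈ S) :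
    ∃ T : Geometry.SimplicialComplex ℝ E, T.faces.Finite ∧ T.space = S := by
  classical
  let T : Geometry.SimplicialComplex ℝ E :=
    { faces := {s | s.Nonempty ∧ IsFlag ℓ s ∧ ∀ v ∈ s, v ∈ S}
      isRelLowerSet_faces := fun s hs => ⟨hs.1, fun t hts ht =>
        ⟨ht, hs.2.1.mono hts, fun v hv => hs.2.2 v (hts hv)⟩⟩
      indep := fun hs => hs.2.1.affineIndependent
      inter_subset_convexHull := fun hs ht => hs.2.1.inter_subset_convexHull ht.2.1 }
  refine ⟨T, ?_, ?_⟩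
  · have hfin : (Set.range (Function.invFun (signVec ℓ))).Finite := Set.finite_range _
    refine (hfin.toFinset.powerset.finite_toSet).subset fun s hs => ?_
    simp only [Finset.coe_powerset, Set.mem_preimage, Set.mem_powerset_iff]
    intro v hv
    simp only [Set.Finite.coe_toFinset]
    exact ⟨signVec ℓ v, hs.2.1.1 v hv⟩
  · apply Set.Subset.antisymm
    · intro x hx
      obtain ⟨s, hs, hxs⟩ := Geometry.SimplicialComplex.mem_space_iff.1 hx
      obtain ⟨v, hv, htop⟩ := hs.2.1.exists_top hs.1
      refine hS v (hs.2.2 v hv) x ?_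
      exact convexHull_min (t := {y | SignLE ℓ y v}) htop (convex_setOf_signLE v) hxs
    · intro x hx
      obtain ⟨s, hne, hs, hsx, hxs⟩ := IsFlag.exists_mem_convexHull hb hS x hx
      exact Geometry.SimplicialComplex.mem_space_iff.2
        ⟨s, ⟨hne, hs, fun v hv => hS x hx v (hsx v hv)⟩, hxs⟩

end Triangulation

/-! ### Piecewise affine functions and their zero sets -/

section PiecewiseAffine

variable {E : Type*} [NormedAddCommGroup E] [NormedSpace ℝ E]

/-- A continuous function whose values are selected from finitely many affine functions. -/
def IsPiecewiseAffine (f : E → ℝ) : Prop :=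
  Continuous f ∧ ∃ L : Set (E →ᵃ[ℝ] ℝ), L.Finite ∧ ∀ x, ∃ ℓ ∈ L, f x = ℓ x

namespace IsPiecewiseAffine

variable {f g : E → ℝ}

theorem of_affine (ℓ : E →ᵃ[ℝ] ℝ) (h : Continuous ℓ) : IsPiecewiseAffine (fun x => ℓ x) :=
  ⟨h, {ℓ}, Set.finite_singleton ℓ, fun _ => ⟨ℓ, rfl, rfl⟩⟩

theorem const (c : ℝ) : IsPiecewiseAffine (fun _ : E => c) :=
  of_affine (AffineMap.const ℝ E c) continuous_const

theorem add (hf : IsPiecewiseAffine f) (hg : IsPiecewiseAffine g) :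
    IsPiecewiseAffine (fun x => f x + g x) := by
  obtain ⟨hfc, L, hL, hfL⟩ := hf
  obtain ⟨hgc, M, hM, hgM⟩ := hg
  refine ⟨hfc.add hgc, Set.image2 (fun a b => a + b) L M, hL.image2 _ hM, fun x => ?_⟩
  obtain ⟨a, ha, hxa⟩ := hfL x
  obtain ⟨b, hb, hxb⟩ := hgM x
  exact ⟨a + b, ⟨a, ha, b, hb, rfl⟩, by simp [hxa, hxb]⟩

theorem const_mul (hf : IsPiecewiseAffine f) (c : ℝ) : IsPiecewiseAffine (fun x => c * f x) := by
  obtain ⟨hfc, L, hL, hfL⟩ := hf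
  refine ⟨hfc.const_mul c, (fun a => c • a) '' L, hL.image _, fun x => ?_⟩
  obtain ⟨a, ha, hxa⟩ := hfL x
  exact ⟨c • a, ⟨a, ha, rfl⟩, by simp [hxa]⟩

theorem neg (hf : IsPiecewiseAffine f) : IsPiecewiseAffine (fun x => -f x) := by
  simpa using hf.const_mul (-1)

theorem sub (hf : IsPiecewiseAffine f) (hg : IsPiecewiseAffine g) :
    IsPiecewiseAffine (fun x => f x - g x) := by
  simpa [sub_eq_add_neg] using hf.add hg.neg

theorem max (hf : IsPiecewiseAffine f) (hg : IsPiecewiseAffine g) :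
    IsPiecewiseAffine (fun x => max (f x) (g x)) := by
  obtain ⟨hfc, L, hL, hfL⟩ := hf
  obtain ⟨hgc, M, hM, hgM⟩ := hg
  refine ⟨hfc.max hgc, L ∪ M, hL.union hM, fun x => ?_⟩
  obtain ⟨a, ha, hxa⟩ := hfL x
  obtain ⟨b, hb, hxb⟩ := hgM x
  rcases max_choice (f x) (g x) with h | h
  · exact ⟨a, Or.inl ha, h.trans hxa⟩
  · exact ⟨b, Or.inr hb, h.trans hxb⟩

theorem min (hf : IsPiecewiseAffine f) (hg : IsPiecewiseAffine g) :
    IsPiecewiseAffine (fun x => min (f x) (g x)) := by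
  simpa [max_neg_neg] using (hf.neg.max hg.neg).neg

theorem abs (hf : IsPiecewiseAffine f) : IsPiecewiseAffine (fun x => |f x|) :=
  hf.max hf.neg

theorem sum {ι : Type*} (s : Finset ι) {F : ι → E → ℝ} (hF : ∀ i ∈ s, IsPiecewiseAffine (F i)) :
    IsPiecewiseAffine (fun x => ∑ i ∈ s, F i x) := by
  classical
  induction s using Finset.induction_on with
  | empty => simpa using const 0
  | insert a s ha ih =>
    simp only [Finset.sum_insert ha]
    exact (hF a (by simp)).add (ih fun i hi => hF i (by simp [hi]))

theorem sup' {ι : Type*} (s : Finset ι) (hs : s.Nonempty) {F : ι → E → ℝ}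
    (hF : ∀ i ∈ s, IsPiecewiseAffine (F i)) :
    IsPiecewiseAffine (fun x => s.sup' hs fun i => F i x) := by
  classical
  induction hs using Finset.Nonempty.cons_induction with
  | singleton a => simpa using hF a (by simp)
  | cons a s ha hne ih =>
    simp only [Finset.sup'_cons hne]
    exact (hF a (by simp)).max (ih fun i hi => hF i (by simp [hi]))

/-- A bounded zero set of a piecewise affine function is the underlying set of a finite simplicial
complex. -/
theorem exists_simplicialComplex (hf : IsPiecewiseAffine f)
    (hb : Bornology.IsBounded {x | f x = 0}) :
    ∃ T : Geometry.SimplicialComplex ℝ E, T.faces.Finite ∧ T.space = {x | f x = 0} := by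
  obtain ⟨hfc, L, hL, hfL⟩ := hf
  have := hL.fintype
  refine exists_simplicialComplex_of_signLE (fun ℓ : L => (ℓ : E →ᵃ[ℝ] ℝ)) hb ?_
  intro x hx y hyx
  by_contra hy
  change f x = 0 at hx
  change f y ≠ 0 at hy
  obtain ⟨δ, hδ, hδL⟩ : ∃ δ > 0, ∀ ℓ ∈ L, ℓ x ≠ 0 → δ ≤ |ℓ x| := by
    rcases ((hL.toFinset).filter fun ℓ : E →ᵃ[ℝ] ℝ => ℓ x ≠ 0).eq_empty_or_nonempty with h | h
    · refine ⟨1, one_pos, fun ℓ hℓ h0 => ?_⟩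
      have : ℓ ∈ (hL.toFinset).filter fun ℓ : E →ᵃ[ℝ] ℝ => ℓ x ≠ 0 := by simp [hℓ, h0]
      simp [h] at this
    · obtain ⟨a, ha, hmin⟩ := Finset.exists_min_image _ (fun ℓ : E →ᵃ[ℝ] ℝ => |ℓ x|) h
      refine ⟨|a x|, abs_pos.2 (Finset.mem_filter.1 ha).2, fun ℓ hℓ h0 => hmin ℓ ?_⟩
      simp [hℓ, h0]
  -- Along the segment from `x` to `y`, a function `ℓ` of the family either vanishes identically or
  -- satisfies `|ℓ| ≥ δ * (1 - s)`. So `|f|` cannot equal the intermediate value `δ / 2 * (1 - s)`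
  -- before `s = 1`, as continuity would require if `f y ≠ 0`.
  let k : ℝ → ℝ := fun s => |f (AffineMap.lineMap x y s)| - δ / 2 * (1 - s)
  have hk : Continuous k := by
    have : Continuous fun s : ℝ => (AffineMap.lineMap x y s : E) := AffineMap.lineMap_continuous
    exact (hfc.comp this).abs.sub (by fun_prop)
  have hk0 : k 0 ≤ 0 := by simp [k, hx]; linarith
  have hk1 : 0 < k 1 := by simpa [k] using hy
  obtain ⟨s, ⟨hs0, hs1⟩, hs⟩ := intermediate_value_Icc zero_le_one hk.continuousOn ⟨hk0, hk1.le⟩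
  have hs1' : s < 1 := lt_of_le_of_ne hs1 (by rintro rfl; exact hk1.ne' hs)
  obtain ⟨ℓ, hℓ, hfℓ⟩ := hfL (AffineMap.lineMap x y s)
  have hs' : |ℓ (AffineMap.lineMap x y s)| = δ / 2 * (1 - s) := by
    rw [← hfℓ]
    exact sub_eq_zero.1 hs
  rw [AffineMap.apply_lineMap, AffineMap.lineMap_apply_ring'] at hs'
  have hℓy := hyx ⟨ℓ, hℓ⟩
  simp only at hℓy
  have hpos : 0 < δ * (1 - s) := mul_pos hδ (by linarith)
  rcases lt_trichotomy (ℓ x) 0 with h | h | h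
  · have h1 := hδL ℓ hℓ h.ne
    rw [abs_of_neg h] at h1
    have h2 := hℓy.2 h.le
    have h3 := neg_le_abs (s * (ℓ y - ℓ x) + ℓ x)
    nlinarith [mul_nonneg hs0 (neg_nonneg.2 h2), mul_le_mul_of_nonneg_right h1 (sub_nonneg.2 hs1)]
  · have h2 : ℓ y = 0 := le_antisymm (hℓy.2 h.le) (hℓy.1 h.ge)
    rw [h, h2] at hs'
    simp only [sub_self, mul_zero, add_zero, abs_zero] at hs'
    linarith
  · have h1 := hδL ℓ hℓ h.ne'
    rw [abs_of_pos h] at h1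
    have h2 := hℓy.1 h.le
    have h3 := le_abs_self (s * (ℓ y - ℓ x) + ℓ x)
    nlinarith [mul_nonneg hs0 h2, mul_le_mul_of_nonneg_right h1 (sub_nonneg.2 hs1)]

end IsPiecewiseAffine

end PiecewiseAffine

/-! ### The region around a finite set of vertices, and its position relative to bonds -/

section LatticeRegion

variable {d : ℕ}

/-- A plateau of height `ε * z i + 1 / 2` around the vertices that share with `z` the coordinates
before `i`; it depends on the coordinates before `i` only. -/
noncomputable def plateau (M : ℝ) (ε : ℤˣ) (i : Fin d) (z : Fin d → ℤ)
    (p : EuclideanSpace ℝ (Fin d)) : ℝ :=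
  min (((ε : ℤ) * z i : ℤ) + 1 / 2) (M * (1 - ∑ j ∈ Finset.Iio i, |p j - z j|))

/-- The extent of the region around `A` from the hyperplane `p i = 0` in direction `ε`, as a
function of the coordinates before `i`. -/
noncomputable def extent (A : Finset (Fin d → ℤ)) (hA : A.Nonempty) (M : ℝ) (ε : ℤˣ) (i : Fin d)
    (p : EuclideanSpace ℝ (Fin d)) : ℝ :=
  max (1 / 2) (A.sup' hA fun z => plateau M ε i z p)

/-- The function whose zero set is the boundary of the region around `A`. -/
noncomputable def excess [Nonempty (Fin d)] (A : Finset (Fin d → ℤ)) (hA : A.Nonempty) (M : ℝ)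
    (p : EuclideanSpace ℝ (Fin d)) : ℝ :=
  (Finset.univ : Finset (Fin d × ℤˣ)).sup' Finset.univ_nonempty
    fun q => ((q.2 : ℤ) : ℝ) * p q.1 - extent A hA M q.2 q.1 p

theorem isPiecewiseAffine_coord (i : Fin d) :
    IsPiecewiseAffine fun p : EuclideanSpace ℝ (Fin d) => p i :=
  IsPiecewiseAffine.of_affine (EuclideanSpace.proj (𝕜 := ℝ) i).toLinearMap.toAffineMap
    (EuclideanSpace.proj (𝕜 := ℝ) i).continuous

theorem isPiecewiseAffine_extent (A : Finset (Fin d → ℤ)) (hA : A.Nonempty) (M : ℝ) (ε : ℤˣ)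
    (i : Fin d) : IsPiecewiseAffine (extent A hA M ε i) :=
  (IsPiecewiseAffine.const _).max <| IsPiecewiseAffine.sup' A hA fun _ _ =>
    (IsPiecewiseAffine.const _).min <| IsPiecewiseAffine.const_mul
      ((IsPiecewiseAffine.const 1).sub <| IsPiecewiseAffine.sum _ fun j _ =>
        ((isPiecewiseAffine_coord j).sub (IsPiecewiseAffine.const _)).abs) M

theorem isPiecewiseAffine_excess [Nonempty (Fin d)] (A : Finset (Fin d → ℤ)) (hA : A.Nonempty)
    (M : ℝ) : IsPiecewiseAffine (excess A hA M) :=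
  IsPiecewiseAffine.sup' _ _ fun q _ =>
    ((isPiecewiseAffine_coord q.1).const_mul _).sub (isPiecewiseAffine_extent A hA M q.2 q.1)

variable {A : Finset (Fin d → ℤ)} {hA : A.Nonempty} {M : ℝ}

/-- This triangularity is what allows straightening one coordinate at a time and escaping along
coordinate rays. -/
theorem extent_congr (ε : ℤˣ) {i : Fin d} {p q : EuclideanSpace ℝ (Fin d)}
    (h : ∀ j < i, p j = q j) : extent A hA M ε i p = extent A hA M ε i q := by
  have : ∀ z, plateau M ε i z p = plateau M ε i z q := fun z => by
    rw [plateau, plateau, Finset.sum_congr rfl fun j hj => by rw [h j (Finset.mem_Iio.1 hj)]]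
  simp only [extent, this]

theorem extent_pos (ε : ℤˣ) (i : Fin d) (p : EuclideanSpace ℝ (Fin d)) :
    0 < extent A hA M ε i p :=
  lt_of_lt_of_le (by norm_num) (le_max_left _ _)

theorem extent_le_iff {ε : ℤˣ} {i : Fin d} {p : EuclideanSpace ℝ (Fin d)} {c : ℝ} :
    extent A hA M ε i p ≤ c ↔ 1 / 2 ≤ c ∧ ∀ z ∈ A, plateau M ε i z p ≤ c := by
  rw [extent, max_le_iff, Finset.sup'_le_iff]

/-- Up to ℓ¹ distance `1 / 2` the sloping side of the plateau is at least `M / 2`, above its cap. -/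
theorem le_extent {z : Fin d → ℤ} (hz : z ∈ A) {ε : ℤˣ} {i : Fin d}
    (hM : (((ε : ℤ) * z i : ℤ) : ℝ) + 1 / 2 ≤ M / 2) (hM0 : 0 ≤ M)
    {p : EuclideanSpace ℝ (Fin d)} (hp : ∑ j ∈ Finset.Iio i, |p j - z j| ≤ 1 / 2) :
    (((ε : ℤ) * z i : ℤ) : ℝ) + 1 / 2 ≤ extent A hA M ε i p := by
  refine le_trans ?_ ((extent_le_iff.1 le_rfl).2 z hz)
  refine le_min le_rfl ?_
  nlinarith

section Excess

variable [Nonempty (Fin d)]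

theorem excess_neg_iff {p : EuclideanSpace ℝ (Fin d)} :
    excess A hA M p < 0 ↔ ∀ i (ε : ℤˣ), ((ε : ℤ) : ℝ) * p i < extent A hA M ε i p := by
  simp [excess, Finset.sup'_lt_iff, sub_neg]

theorem excess_nonpos_iff {p : EuclideanSpace ℝ (Fin d)} :
    excess A hA M p ≤ 0 ↔ ∀ i (ε : ℤˣ), ((ε : ℤ) : ℝ) * p i ≤ extent A hA M ε i p := by
  simp [excess, Finset.sup'_le_iff]

theorem excess_pos_iff {p : EuclideanSpace ℝ (Fin d)} :
    0 < excess A hA M p ↔ ∃ i, ∃ ε : ℤˣ, extent A hA M ε i p < ((ε : ℤ) : ℝ) * p i := by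
  rw [← not_le, excess_nonpos_iff]
  simp

end Excess

/-- Vertices that are equal or neighbours. -/
def WeaklyAdjacent (x y : Fin d → ℤ) : Prop :=
  ∃ k, (∀ j, j ≠ k → x j = y j) ∧ |x k - y k| ≤ 1

theorem WeaklyAdjacent.symm {x y : Fin d → ℤ} (h : WeaklyAdjacent x y) : WeaklyAdjacent y x := by
  obtain ⟨k, hk, h1⟩ := h
  exact ⟨k, fun j hj => (hk j hj).symm, by rwa [abs_sub_comm]⟩

theorem AreNeighbours.weaklyAdjacent {x y : Fin d → ℤ} (h : AreNeighbours x y) :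
    WeaklyAdjacent x y := by
  have h1 : ∑ j, (x j - y j) ^ 2 = 1 := by
    rw [AreNeighbours, EuclideanSpace.dist_eq, Real.sqrt_eq_one] at h
    simp only [latticePoint, Real.dist_eq, sq_abs] at h
    exact_mod_cast h
  obtain ⟨k, hk⟩ : ∃ k, x k - y k ≠ 0 := by
    by_contra! hc
    simp [hc] at h1
  have h2 : 1 ≤ (x k - y k) ^ 2 := by
    have := sq_pos_of_ne_zero hk
    omega
  rw [← Finset.add_sum_erase _ _ (Finset.mem_univ k)] at h1
  have h3 : 0 ≤ ∑ j ∈ Finset.univ.erase k, (x j - y j) ^ 2 :=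
    Finset.sum_nonneg fun j _ => sq_nonneg _
  have h4 : ∑ j ∈ Finset.univ.erase k, (x j - y j) ^ 2 = 0 := by omega
  refine ⟨k, fun j hj => ?_, ?_⟩
  · have := (Finset.sum_eq_zero_iff_of_nonneg fun j _ => sq_nonneg _).1 h4 j
      (Finset.mem_erase.2 ⟨hj, Finset.mem_univ j⟩)
    exact sub_eq_zero.1 (pow_eq_zero_iff two_ne_zero |>.1 this)
  · rw [← sq_le_one_iff_abs_le_one]
    omega

theorem exists_coord_of_mem_bond {x y : Fin d → ℤ} {p : EuclideanSpace ℝ (Fin d)}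
    (hp : p ∈ bond x y) :
    ∃ s : ℝ, 0 ≤ s ∧ s ≤ 1 ∧ ∀ j, p j = x j + s * (y j - x j) := by
  rw [bond, segment_eq_image_lineMap] at hp
  obtain ⟨s, ⟨h0, h1⟩, rfl⟩ := hp
  refine ⟨s, h0, h1, fun j => ?_⟩
  simp [AffineMap.lineMap_apply, latticePoint]
  ring

theorem bond_symm (x y : Fin d → ℤ) : bond x y = bond y x := segment_symm ℝ _ _

theorem latticePoint_mem_bond_self (x : Fin d → ℤ) : latticePoint x ∈ bond x x :=
  left_mem_segment ℝ _ _

theorem WeaklyAdjacent.refl [Nonempty (Fin d)] (x : Fin d → ℤ) : WeaklyAdjacent x x :=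
  ⟨Classical.arbitrary _, fun _ _ => rfl, by simp⟩

theorem sum_abs_sub_le {x y : Fin d → ℤ} {k : Fin d} (hk : ∀ j, j ≠ k → x j = y j)
    (h1 : |x k - y k| ≤ 1) {s : ℝ} (hs : 0 ≤ s) {p : EuclideanSpace ℝ (Fin d)}
    (hp : ∀ j, p j = x j + s * (y j - x j)) (T : Finset (Fin d)) :
    ∑ j ∈ T, |p j - x j| ≤ s := by
  calc ∑ j ∈ T, |p j - x j| ≤ ∑ j, |p j - x j| :=
        Finset.sum_le_univ_sum_of_nonneg fun j => abs_nonneg _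
    _ = |p k - x k| := Finset.sum_eq_single_of_mem k (Finset.mem_univ k) fun j _ hj => by
        rw [hp, hk j hj]; simp
    _ ≤ s := by
        have : |(y k : ℝ) - x k| ≤ 1 := by
          rw [abs_sub_comm]
          exact_mod_cast h1
        rw [hp, add_sub_cancel_left, abs_mul, abs_of_nonneg hs]
        exact mul_le_of_le_one_right hs this

/-- On the half of the bond nearer to `x` the plateau of `x` has full height. This suffices when the
bond is not in direction `i`; when it is, the coordinates before `i` are constant along it and the
plateau of `y` has full height too. -/
theorem units_mul_lt_extent {x y : Fin d → ℤ} (hx : x ∈ A) (hy : y ∈ A)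
    {k : Fin d} (hk : ∀ j, j ≠ k → x j = y j) (h1 : |x k - y k| ≤ 1) {s : ℝ} (hs : 0 ≤ s)
    (hs1 : s ≤ 1 / 2) {p : EuclideanSpace ℝ (Fin d)} (hp : ∀ j, p j = x j + s * (y j - x j))
    {ε : ℤˣ} {i : Fin d} (hM : ∀ z ∈ A, (((ε : ℤ) * z i : ℤ) : ℝ) + 1 / 2 ≤ M / 2) (hM0 : 0 ≤ M) :
    ((ε : ℤ) : ℝ) * p i < extent A hA M ε i p := by
  have hxe := le_extent (hA := hA) hx (hM x hx) hM0 (p := p)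
    ((sum_abs_sub_le hk h1 hs hp _).trans hs1)
  by_cases hki : k = i
  · have hye := le_extent (hA := hA) hy (hM y hy) hM0 (p := p) (by
      rw [Finset.sum_eq_zero fun j hj => ?_]
      · norm_num
      · rw [hp, hk j (hki ▸ (Finset.mem_Iio.1 hj).ne)]
        simp)
    push_cast at hxe hye
    rw [hp]
    nlinarith
  · rw [hp, hk i (Ne.symm hki)] at *
    push_cast at hxe
    rw [sub_self, mul_zero, add_zero]
    linarith

theorem excess_neg_of_mem_bond [Nonempty (Fin d)] {x y : Fin d → ℤ} (hx : x ∈ A) (hy : y ∈ A)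
    (h : WeaklyAdjacent x y)
    (hM : ∀ z ∈ A, ∀ i (ε : ℤˣ), (((ε : ℤ) * z i : ℤ) : ℝ) + 1 / 2 ≤ M / 2) (hM0 : 0 ≤ M)
    {p : EuclideanSpace ℝ (Fin d)} (hp : p ∈ bond x y) : excess A hA M p < 0 := by
  obtain ⟨k, hk, h1⟩ := h
  obtain ⟨s, hs0, hs1, hs⟩ := exists_coord_of_mem_bond hp
  refine excess_neg_iff.2 fun i ε => ?_
  rcases le_total s (1 / 2) with h2 | h2
  · exact units_mul_lt_extent hx hy hk h1 hs0 h2 hs (fun z hz => hM z hz i ε) hM0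
  · refine units_mul_lt_extent hy hx (s := 1 - s) (fun j hj => (hk j hj).symm)
      (by rwa [abs_sub_comm]) (by linarith) (by linarith) (fun j => ?_)
      (fun z hz => hM z hz i ε) hM0
    rw [hs]
    ring

/-- The vertex that agrees with `z` in the first `n` coordinates and vanishes in the others. -/
def truncateFrom (n : ℕ) (z : Fin d → ℤ) : Fin d → ℤ := fun j => if j.val < n then z j else 0

/-- If `w` reached as far as `z` in direction `i`, the truncation of `z` would be `⪯ w`, hence in
`K`. -/
theorem IsDescending.units_mul_lt {K : Set (Fin d → ℤ)} (hK : IsDescending K) {z w : Fin d → ℤ}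
    {i : Fin d} (hz : truncateFrom (i.val + 1) z ∉ K) {ε : ℤˣ} (hε : 1 ≤ (ε : ℤ) * z i)
    (hw : w ∈ K) (hwz : ∀ j < i, w j = z j) : (ε : ℤ) * w i + 1 ≤ (ε : ℤ) * z i := by
  by_contra hc
  have hle : (ε : ℤ) * z i ≤ (ε : ℤ) * w i := by omega
  apply hz
  refine hK.down_closed w hw _ ⟨fun j => ?_, fun j => ?_, fun j hj => ?_⟩
  · rcases lt_trichotomy j i with h | rfl | h
    · rw [truncateFrom, if_pos (by have := Fin.lt_def.1 h; omega), hwz j h]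
      exact mul_self_nonneg _
    · rw [truncateFrom, if_pos (by omega)]
      rcases Int.units_eq_one_or ε with rfl | rfl
      · simp only [Units.val_one, one_mul] at *
        exact mul_nonneg (by omega) (by omega)
      · simp only [Units.val_neg, Units.val_one] at *
        exact mul_nonneg_of_nonpos_of_nonpos (by omega) (by omega)
    · rw [truncateFrom, if_neg (by have := Fin.lt_def.1 h; omega), mul_zero]
  · rcases lt_trichotomy j i with h | rfl | h
    · rw [truncateFrom, if_pos (by have := Fin.lt_def.1 h; omega), hwz j h]
    · rw [truncateFrom, if_pos (by omega)]
      rcases Int.units_eq_one_or ε with rfl | rfl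
      · simp only [Units.val_one, one_mul] at *
        rw [abs_of_nonneg (by omega), abs_of_nonneg (by omega)]
        omega
      · simp only [Units.val_neg, Units.val_one] at *
        rw [abs_of_nonpos (by omega), abs_of_nonpos (by omega)]
        omega
    · rw [truncateFrom, if_neg (by have := Fin.lt_def.1 h; omega)]
      simp
  · obtain ⟨l, hjl, hl⟩ := hj
    have hli : l.val < i.val + 1 := by
      by_contra hn
      exact hl (by rw [truncateFrom, if_neg hn])
    have hji : j < i := Fin.lt_def.2 (by have := Fin.lt_def.1 hjl; omega)
    rw [truncateFrom, if_pos (by have := Fin.lt_def.1 hji; omega), hwz j hji]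

theorem coord_ne_zero_of_truncateFrom {K : Set (Fin d → ℤ)} {z : Fin d → ℤ} {i : Fin d}
    (h : truncateFrom i.val z ∈ K) (h' : truncateFrom (i.val + 1) z ∉ K) : z i ≠ 0 := by
  intro h0
  apply h'
  convert h using 1
  funext j
  unfold truncateFrom
  rcases lt_trichotomy j.val i.val with hj | hj | hj
  · rw [if_pos (by omega), if_pos hj]
  · rw [if_pos (by omega), if_neg (by omega), Fin.ext hj, h0]
  · rw [if_neg (by omega), if_neg (by omega)]

/-- An integer at distance less than one from a point between two adjacent integers is one of
them. -/
theorem Int.eq_or_eq_of_abs_sub_lt_one {a b c : ℤ} (hab : |a - b| ≤ 1) {s : ℝ} (h0 : 0 ≤ s)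
    (h1 : s ≤ 1) (h : |(a : ℝ) + s * (b - a) - c| < 1) : c = a ∨ c = b := by
  rw [abs_lt] at h
  rw [abs_le] at hab
  have : a = b ∨ a = b + 1 ∨ b = a + 1 := by omega
  rcases this with rfl | rfl | rfl
  · left
    have h2 : (c : ℝ) < a + 1 := by linarith
    have h3 : (a : ℝ) < c + 1 := by linarith
    norm_cast at h2 h3
    omega
  · push_cast at h
    have h2 : (c : ℝ) < b + 2 := by nlinarith
    have h3 : (b : ℝ) < c + 1 := by nlinarith
    norm_cast at h2 h3
    omega
  · push_cast at h
    have h2 : (c : ℝ) < a + 2 := by nlinarith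
    have h3 : (a : ℝ) < c + 1 := by nlinarith
    norm_cast at h2 h3
    omega

/-- Coordinate `i` witnesses the excess, in the direction of the sign of `y i`: every plateau that
matters over the bond stops half a unit short of both ends. -/
theorem IsDescending.excess_pos_of_truncateFrom_mem [Nonempty (Fin d)] {K : Set (Fin d → ℤ)}
    (hK : IsDescending K) (hAK : ∀ z, z ∈ A ↔ z ∈ K) (hM0 : 0 ≤ M) {x y : Fin d → ℤ} {i : Fin d}
    (hx : truncateFrom (i.val + 1) x ∉ K) (hy : truncateFrom (i.val + 1) y ∉ K)
    (hyi : truncateFrom i.val y ∈ K) (h : WeaklyAdjacent x y)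
    {p : EuclideanSpace ℝ (Fin d)} (hp : p ∈ bond x y) : 0 < excess A hA M p := by
  obtain ⟨k, hk, hk1⟩ := h
  obtain ⟨s, hs0, hs1, hs⟩ := exists_coord_of_mem_bond hp
  have hy0 : y i ≠ 0 := coord_ne_zero_of_truncateFrom hyi hy
  obtain ⟨ε, hεy⟩ : ∃ ε : ℤˣ, 1 ≤ (ε : ℤ) * y i := by
    rcases lt_or_gt_of_ne hy0 with h | h
    · exact ⟨-1, by simp; omega⟩
    · exact ⟨1, by simp; omega⟩
  -- If the bond is in direction `i`, the ends agree before `i`, so `x i` is nonzero for the same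
  -- reason as `y i`; integers that differ by at most one and are both nonzero have the same sign.
  have hεx : 1 ≤ (ε : ℤ) * x i := by
    by_cases hki : k = i
    · have hxi : truncateFrom i.val x ∈ K := by
        convert hyi using 1
        funext j
        unfold truncateFrom
        split_ifs with hj
        · exact hk j (by rintro rfl; subst hki; omega)
        · rfl
      have hx0 := coord_ne_zero_of_truncateFrom hxi hx
      subst hki
      rw [abs_le] at hk1
      rcases Int.units_eq_one_or ε with rfl | rfl <;>
        simp only [Units.val_neg, Units.val_one] at * <;> omega
    · rwa [hk i (Ne.symm hki)]
  -- Such a `w` agrees before `i` with an end of the bond. One end is enough when the bond is in a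
  -- direction before `i`, since then `x i = y i`; otherwise `w` agrees with both.
  have hlow : ∀ w ∈ K, (∀ j < i, |p j - w j| < 1) →
      (ε : ℤ) * w i + 1 ≤ (ε : ℤ) * x i ∧ (ε : ℤ) * w i + 1 ≤ (ε : ℤ) * y i := by
    intro w hw hwp
    have hj : ∀ j < i, j ≠ k → w j = x j ∧ w j = y j := by
      intro j hji hjk
      have := hwp j hji
      rw [hs] at this
      have h2 := Int.eq_or_eq_of_abs_sub_lt_one (by rw [hk j hjk]; simp) hs0 hs1 this
      rw [hk j hjk] at h2 ⊢
      tauto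
    by_cases hki : k < i
    · have := hwp k hki
      rw [hs] at this
      rw [hk i hki.ne', and_self]
      rcases Int.eq_or_eq_of_abs_sub_lt_one hk1 hs0 hs1 this with h2 | h2
      · rw [← hk i hki.ne']
        refine hK.units_mul_lt hx hεx hw fun j hji => ?_
        by_cases hjk : j = k
        · rw [hjk, h2]
        · exact (hj j hji hjk).1
      · refine hK.units_mul_lt hy hεy hw fun j hji => ?_
        by_cases hjk : j = k
        · rw [hjk, h2]
        · exact (hj j hji hjk).2
    · have hj' : ∀ j < i, j ≠ k := fun j hji hjk => hki (hjk ▸ hji)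
      exact ⟨hK.units_mul_lt hx hεx hw fun j hji => (hj j hji (hj' j hji)).1,
        hK.units_mul_lt hy hεy hw fun j hji => (hj j hji (hj' j hji)).2⟩
  refine excess_pos_iff.2 ⟨i, ε, ?_⟩
  let c : ℝ := min (((ε : ℤ) * x i : ℤ) : ℝ) (((ε : ℤ) * y i : ℤ) : ℝ)
  have hc1 : 1 ≤ c := le_min (by exact_mod_cast hεx) (by exact_mod_cast hεy)
  have hcp : c ≤ ((ε : ℤ) : ℝ) * p i := by
    have h1 : c ≤ ((ε : ℤ) : ℝ) * x i :=
      (min_le_left _ _).trans_eq (Int.cast_mul _ _)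
    have h2 : c ≤ ((ε : ℤ) : ℝ) * y i :=
      (min_le_right _ _).trans_eq (Int.cast_mul _ _)
    rw [hs]
    nlinarith [mul_le_mul_of_nonneg_left h2 hs0,
      mul_le_mul_of_nonneg_left h1 (sub_nonneg.2 hs1)]
  -- The floor `1 / 2` of the extent is covered by `1 ≤ c`; a plateau with some earlier coordinate
  -- at distance at least one is nonpositive here.
  refine lt_of_le_of_lt (b := c - 1 / 2) (extent_le_iff.2 ⟨by linarith, fun w hw => ?_⟩)
    (by linarith)
  by_cases hwp : ∀ j < i, |p j - w j| < 1
  · obtain ⟨h1, h2⟩ := hlow w ((hAK w).1 hw) hwp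
    refine (min_le_left _ _).trans ?_
    have : (((ε : ℤ) * w i : ℤ) : ℝ) + 1 ≤ c :=
      le_min (by exact_mod_cast h1) (by exact_mod_cast h2)
    linarith
  · push Not at hwp
    obtain ⟨j, hji, hj⟩ := hwp
    have h1 : |p j - w j| ≤ ∑ j ∈ Finset.Iio i, |p j - w j| :=
      Finset.single_le_sum (f := fun j => |p j - (w j : ℝ)|) (fun _ _ => abs_nonneg _)
        (Finset.mem_Iio.2 hji)
    refine (min_le_right _ _).trans ?_
    have : M * (1 - ∑ j ∈ Finset.Iio i, |p j - w j|) ≤ 0 :=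
      mul_nonpos_of_nonneg_of_nonpos hM0 (by linarith)
    linarith

theorem IsDescending.excess_pos_of_mem_bond [Nonempty (Fin d)] {K : Set (Fin d → ℤ)}
    (hK : IsDescending K) (hAK : ∀ z, z ∈ A ↔ z ∈ K) (hM0 : 0 ≤ M) {x y : Fin d → ℤ}
    (hx : x ∉ K) (hy : y ∉ K) (h : WeaklyAdjacent x y)
    {p : EuclideanSpace ℝ (Fin d)} (hp : p ∈ bond x y) : 0 < excess A hA M p := by
  classical
  have hfull : ∀ z : Fin d → ℤ, truncateFrom d z = z := fun z => by
    funext j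
    simp [truncateFrom]
  have hzero : ∀ z : Fin d → ℤ, truncateFrom 0 z = 0 := fun z => by
    funext j
    simp [truncateFrom]
  -- The least such `m` is positive because `0 ∈ K`; by minimality one end, truncated one coordinate
  -- earlier, is in `K`.
  have hex : ∃ m, truncateFrom m x ∉ K ∧ truncateFrom m y ∉ K := ⟨d, by simp [hfull, hx, hy]⟩
  have hspec := Nat.find_spec hex
  have hle : Nat.find hex ≤ d := Nat.find_min' hex (by simp [hfull, hx, hy])
  have hmin := fun m => Nat.find_min hex (m := m)
  generalize Nat.find hex = m at hspec hle hmin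
  obtain _ | n := m
  · exact absurd hK.zero_mem (by simpa [hzero] using hspec.1)
  · have hn := hmin n n.lt_succ_self
    rw [not_and_or, not_not, not_not] at hn
    rcases hn with hn | hn
    · rw [bond_symm] at hp
      exact hK.excess_pos_of_truncateFrom_mem hAK hM0 (i := ⟨n, hle⟩) hspec.2 hspec.1 hn h.symm hp
    · exact hK.excess_pos_of_truncateFrom_mem hAK hM0 (i := ⟨n, hle⟩) hspec.1 hspec.2 hn h hp

end LatticeRegion

/-! ### Topology of the region: its boundary is a sphere, and which points are inside -/

section RegionBoundary

/-- Rescale the positive half-line by `b⁻¹` and the negative one by `a⁻¹`. -/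
noncomputable def halfScale (a b t : ℝ) : ℝ := max t 0 / b - max (-t) 0 / a

/-- The inverse of `halfScale`. -/
noncomputable def halfUnscale (a b u : ℝ) : ℝ := max u 0 * b - max (-u) 0 * a

variable {a b : ℝ}

theorem halfScale_of_nonneg {t : ℝ} (ht : 0 ≤ t) : halfScale a b t = t / b := by
  simp [halfScale, ht]

theorem halfScale_of_nonpos {t : ℝ} (ht : t ≤ 0) : halfScale a b t = t / a := by
  simp [halfScale, ht, neg_div]

theorem halfUnscale_of_nonneg {t : ℝ} (ht : 0 ≤ t) : halfUnscale a b t = t * b := by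
  simp [halfUnscale, ht]

theorem halfUnscale_of_nonpos {t : ℝ} (ht : t ≤ 0) : halfUnscale a b t = t * a := by
  simp [halfUnscale, ht]

theorem halfUnscale_halfScale (ha : 0 < a) (hb : 0 < b) (t : ℝ) :
    halfUnscale a b (halfScale a b t) = t := by
  rcases le_total 0 t with h | h
  · rw [halfScale_of_nonneg h, halfUnscale_of_nonneg (by positivity), div_mul_cancel₀ _ hb.ne']
  · rw [halfScale_of_nonpos h, halfUnscale_of_nonpos (div_nonpos_of_nonpos_of_nonneg h ha.le),
      div_mul_cancel₀ _ ha.ne']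

theorem halfScale_injective (ha : 0 < a) (hb : 0 < b) : Function.Injective (halfScale a b) :=
  Function.LeftInverse.injective (halfUnscale_halfScale ha hb)

theorem halfScale_halfUnscale (ha : 0 < a) (hb : 0 < b) (u : ℝ) :
    halfScale a b (halfUnscale a b u) = u := by
  rcases le_total 0 u with h | h
  · rw [halfUnscale_of_nonneg h, halfScale_of_nonneg (by positivity),
      mul_div_cancel_right₀ _ hb.ne']
  · rw [halfUnscale_of_nonpos h, halfScale_of_nonpos (mul_nonpos_of_nonpos_of_nonneg h ha.le),
      mul_div_cancel_right₀ _ ha.ne']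

theorem abs_halfScale_le_one_iff (ha : 0 < a) (hb : 0 < b) {t : ℝ} :
    |halfScale a b t| ≤ 1 ↔ t ≤ b ∧ -t ≤ a := by
  rcases le_total 0 t with h | h
  · rw [halfScale_of_nonneg h, abs_of_nonneg (by positivity), div_le_one hb]
    exact ⟨fun h1 => ⟨h1, by linarith⟩, And.left⟩
  · rw [halfScale_of_nonpos h, abs_of_nonpos (div_nonpos_of_nonpos_of_nonneg h ha.le), ← neg_div,
      div_le_one ha]
    exact ⟨fun h1 => ⟨by linarith, h1⟩, And.right⟩

theorem abs_halfScale_lt_one_iff (ha : 0 < a) (hb : 0 < b) {t : ℝ} :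
    |halfScale a b t| < 1 ↔ t < b ∧ -t < a := by
  rcases le_total 0 t with h | h
  · rw [halfScale_of_nonneg h, abs_of_nonneg (by positivity), div_lt_one hb]
    exact ⟨fun h1 => ⟨h1, by linarith⟩, And.left⟩
  · rw [halfScale_of_nonpos h, abs_of_nonpos (div_nonpos_of_nonpos_of_nonneg h ha.le), ← neg_div,
      div_lt_one ha]
    exact ⟨fun h1 => ⟨by linarith, h1⟩, And.right⟩

variable {d : ℕ}

/-- The boundary of a cube, pulled back by a continuous bijection to a compact set, is a sphere. -/
theorem nonempty_homeomorph_sphere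
    {Φ : EuclideanSpace ℝ (Fin d) → EuclideanSpace ℝ (Fin d)} (hc : Continuous Φ)
    (hΦ : Function.Bijective Φ) (hS : IsCompact {p | ‖WithLp.ofLp (Φ p)‖ = 1}) :
    Nonempty ({p | ‖WithLp.ofLp (Φ p)‖ = 1} ≃ₜ
      Metric.sphere (0 : EuclideanSpace ℝ (Fin d)) 1) := by
  have := isCompact_iff_compactSpace.1 hS
  have hne : ∀ p : {p | ‖WithLp.ofLp (Φ p)‖ = 1}, ‖Φ p‖ ≠ 0 := by
    rintro ⟨p, hp⟩ h0
    rw [norm_eq_zero] at h0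
    simp [h0] at hp
  -- `WithLp.ofLp` carries the sup norm, so `Φ` maps the set onto the boundary of a cube; radial
  -- projection then takes it to the Euclidean sphere.
  let F : {p | ‖WithLp.ofLp (Φ p)‖ = 1} → Metric.sphere (0 : EuclideanSpace ℝ (Fin d)) 1 :=
    fun p => ⟨‖Φ p‖⁻¹ • Φ p, by
      rw [mem_sphere_zero_iff_norm, norm_smul, norm_inv, norm_norm, inv_mul_cancel₀ (hne p)]⟩
  have hF : Continuous F := by
    refine Continuous.subtype_mk ?_ _
    have hcp : Continuous fun p : {p | ‖WithLp.ofLp (Φ p)‖ = 1} => Φ p :=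
      hc.comp continuous_subtype_val
    exact (hcp.norm.inv₀ hne).smul hcp
  have hbij : Function.Bijective F := by
    constructor
    · intro p q hpq
      have h1 : ‖Φ p‖⁻¹ • Φ p = ‖Φ q‖⁻¹ • Φ q := congrArg Subtype.val hpq
      have h2 : ‖Φ p‖⁻¹ = ‖Φ q‖⁻¹ := by
        have := congrArg (fun v => ‖WithLp.ofLp v‖) h1
        simp only [WithLp.ofLp_smul, norm_smul, norm_inv, norm_norm] at this
        rwa [show ‖WithLp.ofLp (Φ p)‖ = 1 from p.2, show ‖WithLp.ofLp (Φ q)‖ = 1 from q.2,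
          mul_one, mul_one] at this
      rw [h2] at h1
      exact Subtype.ext (hΦ.1 (smul_right_injective _ (inv_ne_zero (hne q)) h1))
    · rintro ⟨u, hu⟩
      rw [mem_sphere_zero_iff_norm] at hu
      have hu0 : 0 < ‖WithLp.ofLp u‖ := by
        rw [norm_pos_iff]
        intro h
        have : u = 0 := by
          ext i
          exact congrFun h i
        simp [this] at hu
      obtain ⟨p, hp⟩ := hΦ.2 (‖WithLp.ofLp u‖⁻¹ • u)
      refine ⟨⟨p, ?_⟩, ?_⟩
      · change ‖WithLp.ofLp (Φ p)‖ = 1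
        rw [hp, WithLp.ofLp_smul, norm_smul, norm_inv, norm_norm, inv_mul_cancel₀ hu0.ne']
      · apply Subtype.ext
        change ‖Φ p‖⁻¹ • Φ p = u
        rw [hp, norm_smul, norm_inv, norm_norm, hu, mul_one, inv_inv, smul_smul,
          mul_inv_cancel₀ hu0.ne', one_smul]
  exact ⟨Continuous.homeoOfEquivCompactToT2 (f := Equiv.ofBijective F hbij) hF⟩

variable {A : Finset (Fin d → ℤ)} {hA : A.Nonempty} {M : ℝ}

/-- The triangular map that straightens the region around `A` to a cube. -/
noncomputable def straighten (A : Finset (Fin d → ℤ)) (hA : A.Nonempty) (M : ℝ)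
    (p : EuclideanSpace ℝ (Fin d)) : EuclideanSpace ℝ (Fin d) :=
  WithLp.toLp 2 fun i => halfScale (extent A hA M (-1) i p) (extent A hA M 1 i p) (p i)

theorem continuous_straighten : Continuous (straighten A hA M) := by
  refine (PiLp.continuous_toLp 2 _).comp (continuous_pi fun i => ?_)
  have hp : Continuous fun p : EuclideanSpace ℝ (Fin d) => p i := (isPiecewiseAffine_coord i).1
  have h1 := (isPiecewiseAffine_extent A hA M 1 i).1
  have h2 := (isPiecewiseAffine_extent A hA M (-1) i).1
  exact ((hp.max continuous_const).div h1 fun p => (extent_pos _ _ _).ne').sub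
    ((hp.neg.max continuous_const).div h2 fun p => (extent_pos _ _ _).ne')

/-- Once the coordinates before `i` are known, the two extents are fixed and coordinate `i` is
recovered by inverting `halfScale`. -/
theorem straighten_bijective : Function.Bijective (straighten A hA M) := by
  constructor
  · intro p q hpq
    ext i
    induction i using WellFoundedLT.induction with
    | _ i ih =>
    have h : straighten A hA M p i = straighten A hA M q i := by rw [hpq]
    simp only [straighten, extent_congr _ ih] at h
    exact halfScale_injective (extent_pos _ _ _) (extent_pos _ _ _) h
  · intro u
    suffices h : ∀ n : ℕ, ∃ p, ∀ i : Fin d, i.val < n → straighten A hA M p i = u i by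
      obtain ⟨p, hp⟩ := h d
      exact ⟨p, by ext i; exact hp i i.2⟩
    intro n
    induction n with
    | zero => exact ⟨0, fun i hi => absurd hi (Nat.not_lt_zero _)⟩
    | succ n ih =>
      obtain ⟨p, hp⟩ := ih
      by_cases hn : n < d
      · let k : Fin d := ⟨n, hn⟩
        let q : EuclideanSpace ℝ (Fin d) := WithLp.toLp 2 (Function.update p k
          (halfUnscale (extent A hA M (-1) k p) (extent A hA M 1 k p) (u k)))
        have hq : ∀ j ≠ k, q j = p j := fun j hj => Function.update_of_ne hj _ _
        have hqk : q k = halfUnscale (extent A hA M (-1) k p) (extent A hA M 1 k p) (u k) :=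
          Function.update_self _ _ _
        refine ⟨q, fun i hi => ?_⟩
        have hik : i ≤ k := Nat.lt_succ_iff.1 hi
        have hext : ∀ ε, extent A hA M ε i q = extent A hA M ε i p := fun ε =>
          extent_congr ε fun j hj => hq j (hj.trans_le hik).ne
        simp only [straighten, hext]
        rcases hik.eq_or_lt with rfl | hlt
        · rw [hqk, halfScale_halfUnscale (extent_pos _ _ _) (extent_pos _ _ _)]
        · rw [hq i hlt.ne, ← hp i hlt]
          rfl
      · exact ⟨p, fun i hi => hp i (by omega)⟩

section Nonempty

variable [Nonempty (Fin d)]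

theorem norm_straighten_le_one_iff {p : EuclideanSpace ℝ (Fin d)} :
    ‖WithLp.ofLp (straighten A hA M p)‖ ≤ 1 ↔ excess A hA M p ≤ 0 := by
  rw [pi_norm_le_iff_of_nonneg zero_le_one, excess_nonpos_iff]
  refine forall_congr' fun i => ?_
  rw [Real.norm_eq_abs]
  refine (abs_halfScale_le_one_iff (extent_pos _ _ _) (extent_pos _ _ _)).trans
    ⟨fun h ε => ?_, fun h => ⟨by simpa using h 1, by simpa using h (-1)⟩⟩
  rcases Int.units_eq_one_or ε with rfl | rfl
  · simpa using h.1
  · simpa using h.2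

theorem norm_straighten_lt_one_iff {p : EuclideanSpace ℝ (Fin d)} :
    ‖WithLp.ofLp (straighten A hA M p)‖ < 1 ↔ excess A hA M p < 0 := by
  rw [pi_norm_lt_iff zero_lt_one, excess_neg_iff]
  refine forall_congr' fun i => ?_
  rw [Real.norm_eq_abs]
  refine (abs_halfScale_lt_one_iff (extent_pos _ _ _) (extent_pos _ _ _)).trans
    ⟨fun h ε => ?_, fun h => ⟨by simpa using h 1, by simpa using h (-1)⟩⟩
  rcases Int.units_eq_one_or ε with rfl | rfl
  · simpa using h.1
  · simpa using h.2

theorem norm_straighten_eq_one_iff {p : EuclideanSpace ℝ (Fin d)} :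
    ‖WithLp.ofLp (straighten A hA M p)‖ = 1 ↔ excess A hA M p = 0 := by
  rw [eq_iff_le_not_lt, eq_iff_le_not_lt, norm_straighten_le_one_iff, norm_straighten_lt_one_iff]

theorem isBounded_excess_nonpos
    (hM : ∀ z ∈ A, ∀ i (ε : ℤˣ), (((ε : ℤ) * z i : ℤ) : ℝ) + 1 / 2 ≤ M / 2) (hM1 : 1 ≤ M) :
    Bornology.IsBounded {p | excess A hA M p ≤ 0} := by
  rw [isBounded_iff_forall_norm_le]
  refine ⟨√(∑ _i : Fin d, (M / 2) ^ 2), fun p hp => ?_⟩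
  rw [EuclideanSpace.norm_eq]
  refine Real.sqrt_le_sqrt (Finset.sum_le_sum fun i _ => ?_)
  have hext : ∀ ε, extent A hA M ε i p ≤ M / 2 := fun ε =>
    extent_le_iff.2 ⟨by linarith, fun z hz => (min_le_left _ _).trans (hM z hz i ε)⟩
  have h1 := (excess_nonpos_iff.1 hp i 1).trans (hext 1)
  have h2 := (excess_nonpos_iff.1 hp i (-1)).trans (hext (-1))
  simp only [Units.val_one, Units.val_neg, Int.cast_one, Int.cast_neg, one_mul, neg_mul] at h1 h2
  have h3 : ‖p i‖ ≤ M / 2 := by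
    rw [Real.norm_eq_abs]
    exact abs_le.2 ⟨by linarith, h1⟩
  exact pow_le_pow_left₀ (norm_nonneg _) h3 2

theorem isSimplicialSphere_excess
    (hM : ∀ z ∈ A, ∀ i (ε : ℤˣ), (((ε : ℤ) * z i : ℤ) : ℝ) + 1 / 2 ≤ M / 2) (hM1 : 1 ≤ M) :
    IsSimplicialSphere {p | excess A hA M p = 0} := by
  have hpa := isPiecewiseAffine_excess A hA M
  have hb : Bornology.IsBounded {p | excess A hA M p = 0} :=
    (isBounded_excess_nonpos hM hM1).subset fun p hp => le_of_eq hp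
  refine ⟨hpa.exists_simplicialComplex hb, ?_⟩
  have hcl : IsClosed {p | excess A hA M p = 0} := isClosed_eq hpa.1 continuous_const
  have heq : {p | ‖WithLp.ofLp (straighten A hA M p)‖ = 1} = {p | excess A hA M p = 0} :=
    Set.ext fun p => norm_straighten_eq_one_iff
  rw [← heq]
  apply nonempty_homeomorph_sphere continuous_straighten straighten_bijective
  rw [heq]
  exact Metric.isCompact_of_isClosed_isBounded hcl hb

/-- By the intermediate value theorem the component of `p` cannot leave the bounded region of
nonpositive excess without meeting the zero set. -/
theorem mem_inside_of_excess_neg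
    (hM : ∀ z ∈ A, ∀ i (ε : ℤˣ), (((ε : ℤ) * z i : ℤ) : ℝ) + 1 / 2 ≤ M / 2) (hM1 : 1 ≤ M)
    {p : EuclideanSpace ℝ (Fin d)} (hp : excess A hA M p < 0) :
    p ∈ inside {p | excess A hA M p = 0} := by
  refine ⟨hp.ne, (isBounded_excess_nonpos hM hM1 (hA := hA)).subset fun q hq => ?_⟩
  by_contra hc
  have hpS : p ∈ {p | excess A hA M p = 0}ᶜ := hp.ne
  obtain ⟨r, hr, hr0⟩ := isPreconnected_connectedComponentIn.intermediate_value
    (mem_connectedComponentIn hpS) hq (isPiecewiseAffine_excess A hA M).1.continuousOn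
    ⟨hp.le, (not_le.1 hc).le⟩
  exact connectedComponentIn_subset _ _ hr hr0

/-- On the ray from `p` in a direction `(i, ε)` that witnesses positivity, the extent is constant
while `ε * p i` grows, so an unbounded ray avoids the zero set. -/
theorem notMem_inside_of_excess_pos {p : EuclideanSpace ℝ (Fin d)} (hp : 0 < excess A hA M p) :
    p ∉ inside {p | excess A hA M p = 0} := by
  rintro ⟨-, hb⟩
  obtain ⟨i, ε, hi⟩ := excess_pos_iff.1 hp
  let γ : ℝ → EuclideanSpace ℝ (Fin d) := fun s => p + s • EuclideanSpace.single i ((ε : ℤ) : ℝ)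
  have hγ : Continuous γ := by fun_prop
  have hγi : ∀ s, γ s i = p i + s * ((ε : ℤ) : ℝ) := fun s => by simp [γ]
  have hε : ((ε : ℤ) : ℝ) * ((ε : ℤ) : ℝ) = 1 := by
    exact_mod_cast Int.units_coe_mul_self ε
  have hsub : γ '' Set.Ici 0 ⊆ connectedComponentIn {p | excess A hA M p = 0}ᶜ p := by
    refine (isPreconnected_Ici.image γ hγ.continuousOn).subset_connectedComponentIn
      ⟨0, Set.self_mem_Ici, by simp [γ]⟩ ?_
    rintro _ ⟨s, hs, rfl⟩
    refine (excess_pos_iff.2 ⟨i, ε, ?_⟩).ne'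
    rw [extent_congr ε (q := p) fun j hj => by simp [γ, hj.ne], hγi]
    have : (0 : ℝ) ≤ s := hs
    nlinarith
  obtain ⟨C, hC⟩ := (hb.subset hsub).exists_norm_le
  have hC0 : 0 ≤ C := (norm_nonneg _).trans (hC _ ⟨0, Set.self_mem_Ici, rfl⟩)
  have h1 := (PiLp.norm_apply_le _ i).trans
    (hC _ ⟨C + 1 + |p i|, by simp only [Set.mem_Ici]; positivity, rfl⟩)
  rw [hγi, Real.norm_eq_abs, abs_le] at h1
  rcases Int.units_eq_one_or ε with rfl | rfl
  · simp only [Units.val_one, Int.cast_one, mul_one] at h1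
    linarith [neg_abs_le (p i)]
  · simp only [Units.val_one, Units.val_neg, Int.cast_one, Int.cast_neg, mul_neg, mul_one] at h1
    linarith [le_abs_self (p i)]

end Nonempty

theorem exists_height_bound (A : Finset (Fin d → ℤ)) :
    ∃ M : ℝ, 1 ≤ M ∧ ∀ z ∈ A, ∀ i (ε : ℤˣ), (((ε : ℤ) * z i : ℤ) : ℝ) + 1 / 2 ≤ M / 2 := by
  -- The sum bounds every coordinate of every point of `A`; half of the final `1` supplies the `1 /
  -- 2`.
  refine ⟨2 * (∑ z ∈ A, ∑ i, |(z i : ℝ)|) + 1, ?_, fun z hz i ε => ?_⟩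
  · have : 0 ≤ ∑ z ∈ A, ∑ i, |(z i : ℝ)| := by positivity
    linarith
  · have h1 : |(z i : ℝ)| ≤ ∑ i, |(z i : ℝ)| :=
      Finset.single_le_sum (f := fun i => |(z i : ℝ)|) (fun _ _ => abs_nonneg _)
        (Finset.mem_univ i)
    have h2 : ∑ i, |(z i : ℝ)| ≤ ∑ z ∈ A, ∑ i, |(z i : ℝ)| :=
      Finset.single_le_sum (f := fun z : Fin d → ℤ => ∑ i, |(z i : ℝ)|)
        (fun _ _ => by positivity) hz
    have h3 : (((ε : ℤ) * z i : ℤ) : ℝ) ≤ |(z i : ℝ)| := by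
      rcases Int.units_eq_one_or ε with rfl | rfl
      · simpa using le_abs_self _
      · simpa using neg_le_abs _
    linarith

end RegionBoundary

/-! ### The sphere around a descending set -/

theorem proposition3p1 (d : ℕ) (hd : 2 ≤ d) (K : Set (Fin d → ℤ)) (hK : IsDescending K) :
    ∃ S : Set (EuclideanSpace ℝ (Fin d)),
      IsSimplicialSphere S ∧
      (∀ z : Fin d → ℤ, latticePoint z ∉ S) ∧
      (∀ z : Fin d → ℤ, latticePoint z ∈ inside S ↔ z ∈ K) ∧
      ∀ x y : Fin d → ℤ, AreNeighbours x y →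
        ((S ∩ bond x y).Nonempty ↔ (x ∈ K ∧ y ∉ K) ∨ (x ∉ K ∧ y ∈ K)) := by
  have : Nonempty (Fin d) := ⟨⟨0, by omega⟩⟩
  let A : Finset (Fin d → ℤ) := hK.finite.toFinset
  have hAK : ∀ z, z ∈ A ↔ z ∈ K := fun z => hK.finite.mem_toFinset
  have hA : A.Nonempty := ⟨0, (hAK 0).2 hK.zero_mem⟩
  obtain ⟨M, hM1, hM⟩ := exists_height_bound A
  have hM0 : 0 ≤ M := zero_le_one.trans hM1
  have hneg : ∀ x y, x ∈ K → y ∈ K → WeaklyAdjacent x y → ∀ p ∈ bond x y, excess A hA M p < 0 :=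
    fun x y hx hy h p hp => excess_neg_of_mem_bond ((hAK x).2 hx) ((hAK y).2 hy) h hM hM0 hp
  have hpos : ∀ x y, x ∉ K → y ∉ K → WeaklyAdjacent x y → ∀ p ∈ bond x y, 0 < excess A hA M p :=
    fun x y hx hy h p hp => hK.excess_pos_of_mem_bond hAK hM0 hx hy h hp
  -- A vertex is a degenerate bond, so the statements on bonds also give the sign at vertices.
  have hnegK : ∀ z ∈ K, excess A hA M (latticePoint z) < 0 := fun z hz =>
    hneg z z hz hz (WeaklyAdjacent.refl z) _ (latticePoint_mem_bond_self z)
  have hposK : ∀ z ∉ K, 0 < excess A hA M (latticePoint z) := fun z hz =>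
    hpos z z hz hz (WeaklyAdjacent.refl z) _ (latticePoint_mem_bond_self z)
  have hcross : ∀ x y, x ∈ K → y ∉ K → ({p | excess A hA M p = 0} ∩ bond x y).Nonempty := by
    intro x y hx hy
    obtain ⟨p, hp, hp0⟩ := (convex_segment (𝕜 := ℝ) (latticePoint x)
      (latticePoint y)).isPreconnected.intermediate_value (left_mem_segment ℝ _ _)
      (right_mem_segment ℝ _ _) (isPiecewiseAffine_excess A hA M).1.continuousOn
      ⟨(hnegK x hx).le, (hposK y hy).le⟩
    exact ⟨p, hp0, hp⟩
  refine ⟨{p | excess A hA M p = 0}, isSimplicialSphere_excess hM hM1, fun z hz => ?_,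
    fun z => ⟨fun hz => ?_, fun hz => mem_inside_of_excess_neg hM hM1 (hnegK z hz)⟩,
    fun x y hxy => ⟨?_, ?_⟩⟩
  · by_cases hzK : z ∈ K
    exacts [(hnegK z hzK).ne hz, (hposK z hzK).ne' hz]
  · by_contra hzK
    exact notMem_inside_of_excess_pos (hposK z hzK) hz
  · rintro ⟨p, hp0, hp⟩
    by_cases hx : x ∈ K <;> by_cases hy : y ∈ K
    · exact absurd hp0 (hneg x y hx hy hxy.weaklyAdjacent p hp).ne
    · exact Or.inl ⟨hx, hy⟩
    · exact Or.inr ⟨hx, hy⟩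
    · exact absurd hp0 (hpos x y hx hy hxy.weaklyAdjacent p hp).ne'
  · rintro (⟨hx, hy⟩ | ⟨hx, hy⟩)
    · exact hcross x y hx hy
    · rw [bond_symm]
      exact hcross y x hy hx
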